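/- Let $(\Omega,\mathcal F,\mathbb P)$ be an atomless probability space, $\mathcal X:=L^\infty(\Omega,\mathcal F,\mathbb P)$, and let $X_1,\dots,X_n\in\mathcal X$ be the initial endowments of $n$ agents, with aggregate endowment $S:=\sum_{i=1}^n X_i$. Let $U_1,\dots,U_n:\mathcal X\to\mathbb R$ be the agents' utility functionals. An allocation is a vector $(Y_1,\dots,Y_n)\in\mathcal X^n$ with $\sum_{i=1}^n Y_i=S$. It is comonotone if there is an event $A$ with $\mathbb P(A)=1$ such that $[Y_i(\omega_1)-Y_i(\omega_2)]\,[Y_j(\omega_1)-Y_j(\omega_2)]\ge 0$ for all $\omega_1,\omega_2\in A$ and all $i,j$. It is individually rational if $U_i(Y_i)\ge U_i(X_i)$ for all $i$. A (comonotone) allocation $(Y_i^*)$ is called (comonotone) Pareto optimal if it is individually rational and there is no individually rational (comonotone) allocation $(Y_i)$ such that $U_i(Y_i)\ge U_i(Y_i^*)$ for all $i$, with at least one strict inequality. Let $\mathcal{PO}$ be the set of Pareto-optimal allocations and $\mathcal{CPO}$ the set of comonotone Pareto-optimal allocations (that is, comonotone allocations not dominated by any other individually rational comonotone allocation), and define $$\mathcal{UPF}:=\{(U_1(Y_1),\dots,U_n(Y_n))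 : (Y_i)\in\mathcal{PO}\},\qquad \mathcal{CUPF}:=\{(U_1(Y_1),\dots,U_n(Y_n)) : (Y_i)\in\mathcal{CPO}\}.$$ Suppose that for each $i$: - $U_i$ is concave; - $U_i$ is S.S.D. preserving, i.e. $U_i(Z_1)\le U_i(Z_2)$ whenever $Z_1,Z_2\in\mathcal X$ satisfy $\mathbb E[\phi(Z_1)]\le\mathbb E[\phi(Z_2)]$ for every increasing (that is, nondecreasing) concave function $\phi:\mathbb R\to\mathbb R$; - for every $Z\in\mathcal X$, the function $c\mapsto U_i(Z+c)$ from $\mathbb R$ to $\mathbb R$ is continuous, strictly increasing, and satisfies $\lim_{c\to\infty}U_i(Z+c)=\infty$. Then $\mathcal{UPF}=\mathcal{CUPF}$. -/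

import Mathlib

open MeasureTheory Filter
open scoped ENNReal

namespace RiskSharing

/-- The measure has no atoms in the sense of measure theory: every measurable set of positive
measure has a measurable subset of strictly smaller positive measure. -/
def Atomless {Ω : Type*} [MeasurableSpace Ω] (μ : Measure Ω) : Prop :=
  ∀ A : Set Ω, MeasurableSet A → 0 < μ A →
    ∃ B : Set Ω, B ⊆ A ∧ MeasurableSet B ∧ 0 < μ B ∧ μ B < μ A

/-- `Z₁ ≼ Z₂` in the increasing concave order (second-order stochastic dominance): for every
increasing concave `φ : ℝ → ℝ` one has `E[φ(Z₁)] ≤ E[φ(Z₂)]` when these expectations are defined.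
(For essentially bounded `Z₁`, `Z₂` they always are, as a concave `φ : ℝ → ℝ` is continuous.) -/
def ICVLe {Ω : Type*} [MeasurableSpace Ω] (μ : Measure Ω) (Z₁ Z₂ : Lp ℝ ∞ μ) : Prop :=
  ∀ φ : ℝ → ℝ, Monotone φ → ConcaveOn ℝ Set.univ φ →
    Integrable (fun ω => φ (Z₁ ω)) μ → Integrable (fun ω => φ (Z₂ ω)) μ →
      ∫ ω, φ (Z₁ ω) ∂μ ≤ ∫ ω, φ (Z₂ ω) ∂μ

/-- A functional on `L^∞` is S.S.D. preserving if it respects the increasing concave order. -/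
def SSDPreserving {Ω : Type*} [MeasurableSpace Ω] (μ : Measure Ω) (U : Lp ℝ ∞ μ → ℝ) : Prop :=
  ∀ Z₁ Z₂ : Lp ℝ ∞ μ, ICVLe μ Z₁ Z₂ → U Z₁ ≤ U Z₂

/-- For every `Z`, the function `c ↦ U (Z + c)` is continuous, strictly increasing, and tends to
infinity as `c → ∞`. -/
def CashRegular {Ω : Type*} [MeasurableSpace Ω] (μ : Measure Ω) [IsFiniteMeasure μ]
    (U : Lp ℝ ∞ μ → ℝ) : Prop :=
  ∀ Z : Lp ℝ ∞ μ,
    Continuous (fun c : ℝ => U (Z + Lp.const ∞ μ c)) ∧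
    StrictMono (fun c : ℝ => U (Z + Lp.const ∞ μ c)) ∧
    Tendsto (fun c : ℝ => U (Z + Lp.const ∞ μ c)) atTop atTop

/-- The set `𝒜` of allocations of the aggregate endowment `∑ i, X i`. -/
def Allocations {Ω : Type*} [MeasurableSpace Ω] (μ : Measure Ω) {n : ℕ}
    (X : Fin n → Lp ℝ ∞ μ) : Set (Fin n → Lp ℝ ∞ μ) :=
  {Y | ∑ i, Y i = ∑ i, X i}

/-- Comonotonicity of a random vector, for almost-everywhere classes: outside a null set, any two
components never move in opposite directions. -/
def Comonotone {Ω : Type*} [MeasurableSpace Ω] (μ : Measure Ω) {n : ℕ}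
    (Y : Fin n → Lp ℝ ∞ μ) : Prop :=
  ∃ A ∈ ae μ, ∀ ω₁ ∈ A, ∀ ω₂ ∈ A, ∀ i j : Fin n,
    0 ≤ (Y i ω₁ - Y i ω₂) * (Y j ω₁ - Y j ω₂)

/-- The set `𝒜_C` of comonotone allocations. -/
def ComonotoneAllocations {Ω : Type*} [MeasurableSpace Ω] (μ : Measure Ω) {n : ℕ}
    (X : Fin n → Lp ℝ ∞ μ) : Set (Fin n → Lp ℝ ∞ μ) :=
  {Y | Y ∈ Allocations μ X ∧ Comonotone μ Y}

/-- Individual rationality with respect to the initial endowments `X`. -/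
def IndividuallyRational {Ω : Type*} [MeasurableSpace Ω] (μ : Measure Ω) {n : ℕ}
    (U : Fin n → Lp ℝ ∞ μ → ℝ) (X Y : Fin n → Lp ℝ ∞ μ) : Prop :=
  ∀ i, U i (X i) ≤ U i (Y i)

/-- `Y` Pareto-dominates `Y'`: every agent is at least as well off, at least one strictly so. -/
def Dominates {Ω : Type*} [MeasurableSpace Ω] (μ : Measure Ω) {n : ℕ}
    (U : Fin n → Lp ℝ ∞ μ → ℝ) (Y Y' : Fin n → Lp ℝ ∞ μ) : Prop :=
  (∀ i, U i (Y' i) ≤ U i (Y i)) ∧ ∃ i, U i (Y' i) < U i (Y i)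

/-- The set `PO` of Pareto-optimal allocations. -/
def ParetoOptima {Ω : Type*} [MeasurableSpace Ω] (μ : Measure Ω) {n : ℕ}
    (U : Fin n → Lp ℝ ∞ μ → ℝ) (X : Fin n → Lp ℝ ∞ μ) : Set (Fin n → Lp ℝ ∞ μ) :=
  {Y | Y ∈ Allocations μ X ∧ IndividuallyRational μ U X Y ∧
    ¬ ∃ Y' ∈ Allocations μ X, IndividuallyRational μ U X Y' ∧ Dominates μ U Y' Y}

/-- The set `CPO` of comonotone Pareto-optimal allocations, i.e. those that are Pareto optimal in
the market where only comonotone allocations are admissible. -/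
def ComonotoneParetoOptima {Ω : Type*} [MeasurableSpace Ω] (μ : Measure Ω) {n : ℕ}
    (U : Fin n → Lp ℝ ∞ μ → ℝ) (X : Fin n → Lp ℝ ∞ μ) : Set (Fin n → Lp ℝ ∞ μ) :=
  {Y | Y ∈ ComonotoneAllocations μ X ∧ IndividuallyRational μ U X Y ∧
    ¬ ∃ Y' ∈ ComonotoneAllocations μ X, IndividuallyRational μ U X Y' ∧ Dominates μ U Y' Y}

/-- The utility possibility frontier. -/
def UPF {Ω : Type*} [MeasurableSpace Ω] (μ : Measure Ω) {n : ℕ}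
    (U : Fin n → Lp ℝ ∞ μ → ℝ) (X : Fin n → Lp ℝ ∞ μ) : Set (Fin n → ℝ) :=
  {u | ∃ Y ∈ ParetoOptima μ U X, ∀ i, u i = U i (Y i)}

/-- The comonotone utility possibility frontier. -/
def CUPF {Ω : Type*} [MeasurableSpace Ω] (μ : Measure Ω) {n : ℕ}
    (U : Fin n → Lp ℝ ∞ μ → ℝ) (X : Fin n → Lp ℝ ∞ μ) : Set (Fin n → ℝ) :=
  {u | ∃ Y ∈ ComonotoneParetoOptima μ U X, ∀ i, u i = U i (Y i)}

end RiskSharing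

namespace RiskSharing

/-! Everything rests on comonotone improvement (`exists_comonotone_improvement`): since utilities
respect the dominance order, any allocation can be replaced by a comonotone one that hurts nobody,
and the two frontiers then agree by a short order argument. For the improvement, fix a bound `M` for
`Y`. The allocations bounded by `M` whose components dominate those of `Y` for all concave test
functions form a closed convex set in a Hilbert space, so one of them has least total second moment.
If two of its components moved in opposite directions with positive probability, a small mean-zero
transfer between them would pull both towards fixed levels. This respects all constraints
(`sub_mem_boundedConcaveUpper`) and strictly lowers the second moment
(`norm_sub_sq_le_of_transfer`), a contradiction. -/

/-! ### Concave functions on the line -/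

/-- The condition on `w` says that `z - w` lies between `m` and `z`. A supergradient `σ` at `m`
bounds the chord slopes on either side; as it depends on neither `z` nor `w`, the term `σ * w`
vanishes on integrating a mean-zero `w`. -/
theorem exists_supergradient_transfer {φ : ℝ → ℝ} (hφ : ConcaveOn ℝ Set.univ φ) (m : ℝ) :
    ∃ σ : ℝ, ∀ z w : ℝ, w ^ 2 ≤ w * (z - m) → φ z - σ * w ≤ φ (z - w) := by
  have slope {x y z : ℝ} (hxy : x < y) (hyz : y < z) :
      (φ z - φ y) / (z - y) ≤ (φ y - φ x) / (y - x) :=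
    hφ.slope_anti_adjacent (Set.mem_univ _) (Set.mem_univ _) hxy hyz
  obtain ⟨σ, hr, hl⟩ := exists_between_of_forall_le
    (s := (fun x => (φ x - φ m) / (x - m)) '' Set.Ioi m)
    (t := (fun x => (φ m - φ x) / (m - x)) '' Set.Iio m)
    (Set.nonempty_Ioi.image _) (Set.nonempty_Iio.image _) (by
      rintro _ ⟨x, hx, rfl⟩ _ ⟨y, hy, rfl⟩
      exact slope hy hx)
  have hr' {x : ℝ} (hx : m < x) : (φ x - φ m) / (x - m) ≤ σ := hr ⟨x, hx, rfl⟩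
  have hl' {x : ℝ} (hx : x < m) : σ ≤ (φ m - φ x) / (m - x) := hl ⟨x, hx, rfl⟩
  refine ⟨σ, fun z w h => ?_⟩
  rcases lt_trichotomy w 0 with hw | rfl | hw
  · have hz : z - w ≤ m := by nlinarith
    have key : σ ≤ (φ (z - w) - φ z) / (z - w - z) := by
      rcases hz.eq_or_lt with rfl | hz
      · exact hl' (by linarith)
      · exact (hl' hz).trans (slope (by linarith) hz)
    rw [le_div_iff₀ (by linarith)] at key
    linarith
  · simp
  · have hz : m ≤ z - w := by nlinarith
    have key : (φ z - φ (z - w)) / (z - (z - w)) ≤ σ := by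
      rcases hz.eq_or_lt with rfl | hz
      · exact hr' (by linarith)
      · exact (slope hz (by linarith)).trans (hr' hz)
    rw [div_le_iff₀ (by linarith)] at key
    linarith

theorem continuous_of_concaveOn_univ {φ : ℝ → ℝ} (hφ : ConcaveOn ℝ Set.univ φ) :
    Continuous φ :=
  continuousOn_univ.mp (hφ.continuousOn isOpen_univ)

theorem exists_abs_le_of_continuous {φ : ℝ → ℝ} (hφ : Continuous φ) (M : ℝ) :
    ∃ C : ℝ, ∀ x : ℝ, |x| ≤ M → |φ x| ≤ C := by
  obtain ⟨C, hC⟩ := (isCompact_Icc (a := -M) (b := M)).exists_bound_of_continuousOn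
    hφ.continuousOn
  exact ⟨C, fun x hx => hC x (abs_le.mp hx)⟩

/-! ### Almost-everywhere preliminaries -/

section

variable {Ω : Type*} [MeasurableSpace Ω] {μ : Measure Ω}

theorem norm_sq_eq_integral_sq (z : Lp ℝ 2 μ) : ‖z‖ ^ 2 = ∫ ω, z ω ^ 2 ∂μ := by
  rw [← real_inner_self_eq_norm_sq, L2.inner_def]
  simp [sq]

theorem exists_mem_of_measure_ne_zero_of_ae {A : Set Ω} (hA : μ A ≠ 0) {p : Ω → Prop}
    (hp : ∀ᵐ ω ∂μ, p ω) : ∃ ω ∈ A, p ω := by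
  by_contra! hn
  exact hA (measure_mono_null hn hp)

/-- If no two components move in opposite directions with positive probability, the vector is
comonotone off a null set. -/
theorem exists_ae_forall_mul_nonneg {n : ℕ} {f : Fin n → Ω → ℝ}
    (hf : ∀ (i j : Fin n) (a b c d : ℝ), a < b → c < d →
      μ {ω | b < f i ω ∧ f j ω < c} = 0 ∨ μ {ω | f i ω < a ∧ d < f j ω} = 0) :
    ∃ A ∈ ae μ, ∀ ω₁ ∈ A, ∀ ω₂ ∈ A, ∀ i j : Fin n,
      0 ≤ (f i ω₁ - f i ω₂) * (f j ω₁ - f j ω₂) := by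
  -- Rational thresholds leave only countably many null sets to discard, yet separate any two points
  -- moving oppositely.
  let G : Set Ω := {ω | ∀ (i j : Fin n) (a b c d : ℚ),
    (μ {ω | (b : ℝ) < f i ω ∧ f j ω < c} = 0 → ¬ ((b : ℝ) < f i ω ∧ f j ω < c)) ∧
    (μ {ω | f i ω < a ∧ (d : ℝ) < f j ω} = 0 → ¬ (f i ω < a ∧ (d : ℝ) < f j ω))}
  have hG : ∀ᵐ ω ∂μ, ω ∈ G := by
    simp only [G, Set.mem_ofPred_eq]
    simp only [ae_all_iff]
    intro i j a b c d
    refine Filter.Eventually.and ?_ ?_ <;> rw [Filter.eventually_imp_distrib_left] <;>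
      intro h0 <;> simpa [ae_iff] using h0
  have key : ∀ ω₁ ∈ G, ∀ ω₂ ∈ G, ∀ i j : Fin n,
      ¬ (f i ω₂ < f i ω₁ ∧ f j ω₁ < f j ω₂) := by
    rintro ω₁ h₁ ω₂ h₂ i j ⟨hi, hj⟩
    obtain ⟨b, hb, hb'⟩ := exists_rat_btwn hi
    obtain ⟨a, ha, ha'⟩ := exists_rat_btwn hb
    obtain ⟨c, hc, hc'⟩ := exists_rat_btwn hj
    obtain ⟨d, hd, hd'⟩ := exists_rat_btwn hc'
    rcases hf i j a b c d ha' hd with h | h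
    · exact (h₁ i j a b c d).1 h ⟨hb', hc⟩
    · exact (h₂ i j a b c d).2 h ⟨ha, hd'⟩
  refine ⟨G, hG, fun ω₁ h₁ ω₂ h₂ i j => ?_⟩
  by_contra! hneg
  rcases mul_neg_iff.mp hneg with ⟨h, h'⟩ | ⟨h, h'⟩
  · exact key ω₁ h₁ ω₂ h₂ i j ⟨by linarith, by linarith⟩
  · exact key ω₂ h₂ ω₁ h₁ i j ⟨by linarith, by linarith⟩

theorem exists_ae_abs_le {n : ℕ} (Y : Fin n → Lp ℝ ∞ μ) :
    ∃ M : ℝ, ∀ i, ∀ᵐ ω ∂μ, |Y i ω| ≤ M := by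
  refine ⟨∑ i, ‖Y i‖, fun i => ?_⟩
  have hY : ∀ᵐ ω ∂μ, ‖Y i ω‖ₑ ≤ eLpNorm (Y i) ∞ μ := ae_le_eLpNormEssSup
  filter_upwards [hY] with ω h
  have h' := ENNReal.toReal_mono (Lp.eLpNorm_ne_top (Y i)) h
  rw [toReal_enorm, ← Lp.norm_def] at h'
  exact h'.trans (Finset.single_le_sum (f := fun i => ‖Y i‖) (fun _ _ => norm_nonneg _)
    (Finset.mem_univ i))

theorem abs_midpoint_le {A B : Set Ω} (hA : μ A ≠ 0) (hB : μ B ≠ 0) {z : Ω → ℝ} {a b M : ℝ}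
    (hab : a < b) (hzA : ∀ ω ∈ A, b < z ω) (hzB : ∀ ω ∈ B, z ω < a)
    (hM : ∀ᵐ ω ∂μ, |z ω| ≤ M) : |(a + b) / 2| ≤ M := by
  obtain ⟨ω, hω, h⟩ := exists_mem_of_measure_ne_zero_of_ae hA hM
  obtain ⟨ω', hω', h'⟩ := exists_mem_of_measure_ne_zero_of_ae hB hM
  have := hzA ω hω
  have := hzB ω' hω'
  rw [abs_le] at *
  constructor <;> linarith

variable [IsProbabilityMeasure μ]

theorem integrable_comp_of_abs_le {φ : ℝ → ℝ} (hφ : Continuous φ) {z : Ω → ℝ}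
    (hz : AEStronglyMeasurable z μ) {M : ℝ} (hM : ∀ᵐ ω ∂μ, |z ω| ≤ M) :
    Integrable (fun ω => φ (z ω)) μ := by
  obtain ⟨C, hC⟩ := exists_abs_le_of_continuous hφ M
  exact Integrable.of_bound (hφ.comp_aestronglyMeasurable hz) C (hM.mono fun ω h => hC _ h)

/-! ### The constraint set for one component -/

/-- Square-integrable functions bounded by `M` that dominate `y` in the concave order. -/
def boundedConcaveUpper (μ : Measure Ω) (y : Ω → ℝ) (M : ℝ) : Set (Lp ℝ 2 μ) :=
  {z | (∀ᵐ ω ∂μ, |z ω| ≤ M) ∧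
    ∀ φ : ℝ → ℝ, ConcaveOn ℝ Set.univ φ → ∫ ω, φ (y ω) ∂μ ≤ ∫ ω, φ (z ω) ∂μ}

theorem convex_boundedConcaveUpper (y : Ω → ℝ) (M : ℝ) :
    Convex ℝ (boundedConcaveUpper μ y M) := by
  rintro z₁ ⟨hb₁, hz₁⟩ z₂ ⟨hb₂, hz₂⟩ a b ha hb hab
  have hco : (a • z₁ + b • z₂ : Lp ℝ 2 μ) =ᵐ[μ] fun ω => a * z₁ ω + b * z₂ ω := by
    filter_upwards [Lp.coeFn_add (a • z₁) (b • z₂), Lp.coeFn_smul a z₁, Lp.coeFn_smul b z₂]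
      with ω h h₁ h₂
    rw [h, Pi.add_apply, h₁, h₂]
    rfl
  have hbd : ∀ᵐ ω ∂μ, |(a • z₁ + b • z₂ : Lp ℝ 2 μ) ω| ≤ M := by
    filter_upwards [hco, hb₁, hb₂] with ω h h₁ h₂
    rw [h]
    rw [abs_le] at *
    constructor <;> nlinarith
  refine ⟨hbd, fun φ hφ => ?_⟩
  have hc := continuous_of_concaveOn_univ hφ
  have i₁ := integrable_comp_of_abs_le hc (Lp.aestronglyMeasurable z₁) hb₁
  have i₂ := integrable_comp_of_abs_le hc (Lp.aestronglyMeasurable z₂) hb₂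
  calc ∫ ω, φ (y ω) ∂μ = a * ∫ ω, φ (y ω) ∂μ + b * ∫ ω, φ (y ω) ∂μ := by
        rw [← add_mul, hab, one_mul]
    _ ≤ a * ∫ ω, φ (z₁ ω) ∂μ + b * ∫ ω, φ (z₂ ω) ∂μ := by
        exact add_le_add (mul_le_mul_of_nonneg_left (hz₁ φ hφ) ha)
          (mul_le_mul_of_nonneg_left (hz₂ φ hφ) hb)
    _ = ∫ ω, (a * φ (z₁ ω) + b * φ (z₂ ω)) ∂μ := by
        rw [integral_add (i₁.const_mul a) (i₂.const_mul b), integral_const_mul,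
          integral_const_mul]
    _ ≤ _ := by
        refine integral_mono_ae ((i₁.const_mul a).add (i₂.const_mul b))
          (integrable_comp_of_abs_le hc (Lp.aestronglyMeasurable _) hbd) ?_
        filter_upwards [hco] with ω h
        simp only [h]
        exact hφ.2 (Set.mem_univ _) (Set.mem_univ _) ha hb hab

/-- The bound `M` allows dominated convergence along an a.e. convergent subsequence. -/
theorem isClosed_boundedConcaveUpper (y : Ω → ℝ) (M : ℝ) :
    IsClosed (boundedConcaveUpper μ y M) := by
  refine isClosed_of_closure_subset fun z hz => ?_
  obtain ⟨u, hu, hlim⟩ := mem_closure_iff_seq_limit.mp hz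
  obtain ⟨ns, -, hns⟩ := (tendstoInMeasure_of_tendsto_Lp hlim).exists_seq_tendsto_ae
  have hub : ∀ᵐ ω ∂μ, ∀ k, |u k ω| ≤ M := ae_all_iff.mpr fun k => (hu k).1
  refine ⟨?_, fun φ hφ => ?_⟩
  · filter_upwards [hns, hub] with ω h hb
    exact le_of_tendsto' h.abs fun k => hb (ns k)
  · have hc := continuous_of_concaveOn_univ hφ
    obtain ⟨C, hC⟩ := exists_abs_le_of_continuous hc M
    have ht : Tendsto (fun k => ∫ ω, φ (u (ns k) ω) ∂μ) atTop (nhds (∫ ω, φ (z ω) ∂μ)) := by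
      refine tendsto_integral_of_dominated_convergence (fun _ => C)
        (fun k => hc.comp_aestronglyMeasurable (Lp.aestronglyMeasurable _))
        (integrable_const C) (fun k => ?_) ?_
      · filter_upwards [hub] with ω hb
        exact hC _ (hb (ns k))
      · filter_upwards [hns] with ω h
        exact (hc.tendsto _).comp h
    exact ge_of_tendsto' ht fun k => (hu (ns k)).2 φ hφ

/-! ### Mean-zero transfers towards a level -/

theorem sub_mem_boundedConcaveUpper {y : Ω → ℝ} {M m : ℝ} {z w : Lp ℝ 2 μ}
    (hz : z ∈ boundedConcaveUpper μ y M) (hm : |m| ≤ M) (hw0 : ∫ ω, w ω ∂μ = 0)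
    (hw : ∀ᵐ ω ∂μ, w ω ^ 2 ≤ w ω * (z ω - m)) : z - w ∈ boundedConcaveUpper μ y M := by
  have hbd : ∀ᵐ ω ∂μ, |(z - w : Lp ℝ 2 μ) ω| ≤ M := by
    filter_upwards [Lp.coeFn_sub z w, hw, hz.1] with ω h hw hb
    rw [h, Pi.sub_apply]
    rw [abs_le] at *
    rcases lt_trichotomy (w ω) 0 with h0 | h0 | h0
    · constructor <;> nlinarith
    · simpa [h0] using hb
    · constructor <;> nlinarith
  refine ⟨hbd, fun φ hφ => (hz.2 φ hφ).trans ?_⟩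
  have hc := continuous_of_concaveOn_univ hφ
  obtain ⟨σ, hσ⟩ := exists_supergradient_transfer hφ m
  have iz := integrable_comp_of_abs_le hc (Lp.aestronglyMeasurable z) hz.1
  have iw : Integrable (fun ω => σ * w ω) μ :=
    ((Lp.memLp w).integrable one_le_two).const_mul σ
  calc ∫ ω, φ (z ω) ∂μ = ∫ ω, (φ (z ω) - σ * w ω) ∂μ := by
        rw [integral_sub iz iw, integral_const_mul, hw0, mul_zero, sub_zero]
    _ ≤ _ := by
        refine integral_mono_ae (iz.sub iw)
          (integrable_comp_of_abs_le hc (Lp.aestronglyMeasurable _) hbd) ?_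
        filter_upwards [Lp.coeFn_sub z w, hw] with ω h hw
        simp only [h, Pi.sub_apply]
        exact hσ _ _ hw

/-- Expand the square and use `w * z ≥ w ^ 2 + m * w`; the linear term integrates to zero. -/
theorem norm_sub_sq_le_of_transfer {m : ℝ} {z w : Lp ℝ 2 μ} (hw0 : ∫ ω, w ω ∂μ = 0)
    (hw : ∀ᵐ ω ∂μ, w ω ^ 2 ≤ w ω * (z ω - m)) : ‖z - w‖ ^ 2 ≤ ‖z‖ ^ 2 - ‖w‖ ^ 2 := by
  have i (f : Lp ℝ 2 μ) : Integrable (fun ω => f ω ^ 2) μ := (Lp.memLp f).integrable_sq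
  have iw : Integrable (fun ω => 2 * m * w ω) μ :=
    ((Lp.memLp w).integrable one_le_two).const_mul _
  rw [norm_sq_eq_integral_sq, norm_sq_eq_integral_sq, norm_sq_eq_integral_sq]
  calc _ ≤ ∫ ω, (z ω ^ 2 - w ω ^ 2 - 2 * m * w ω) ∂μ := by
        refine integral_mono_ae (i _) (((i z).sub (i w)).sub iw) ?_
        filter_upwards [Lp.coeFn_sub z w, hw] with ω h hw
        simp only [h, Pi.sub_apply]
        nlinarith
    _ = _ := by
        rw [integral_sub (f := fun ω => z ω ^ 2 - w ω ^ 2) ((i z).sub (i w)) iw,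
          integral_sub (i z) (i w), integral_const_mul, hw0, mul_zero, sub_zero]

/-- A balanced transfer from `A` to `B`, on the scale `h`. -/
theorem exists_balanced_transfer {A B : Set Ω} (hA : MeasurableSet A) (hB : MeasurableSet B)
    (hAB : Disjoint A B) (hA0 : μ A ≠ 0) (hB0 : μ B ≠ 0) {h : ℝ} (hh : 0 < h) :
    ∃ w : Lp ℝ 2 μ, ∫ ω, w ω ∂μ = 0 ∧ w ≠ 0 ∧ ∀ᵐ ω ∂μ,
      (ω ∈ A → 0 ≤ w ω ∧ w ω ≤ h) ∧ (ω ∈ B → -h ≤ w ω ∧ w ω ≤ 0) ∧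
        (ω ∉ A → ω ∉ B → w ω = 0) := by
  have pA : 0 < μ.real A := ENNReal.toReal_pos hA0 (measure_ne_top _ _)
  have pB : 0 < μ.real B := ENNReal.toReal_pos hB0 (measure_ne_top _ _)
  have qA : μ.real A ≤ 1 := measureReal_le_one
  have qB : μ.real B ≤ 1 := measureReal_le_one
  -- Weighting each set by the measure of the other makes the mean zero; measures at most 1 keep the
  -- heights within `h`.
  let f : Ω → ℝ := A.indicator (fun _ => h * μ.real B) - B.indicator (fun _ => h * μ.real A)
  have fm : MemLp f 2 μ := (memLp_indicator_const 2 hA _ (Or.inr (measure_ne_top _ _))).sub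
    (memLp_indicator_const 2 hB _ (Or.inr (measure_ne_top _ _)))
  have fA {ω} (hω : ω ∈ A) : f ω = h * μ.real B := by
    simp [f, hω, hAB.notMem_of_mem_left hω]
  have fB {ω} (hω : ω ∈ B) : f ω = -(h * μ.real A) := by
    simp [f, hω, hAB.notMem_of_mem_right hω]
  refine ⟨fm.toLp f, ?_, ?_, ?_⟩
  · rw [integral_congr_ae fm.coeFn_toLp]
    simp only [f, Pi.sub_apply]
    rw [integral_sub ((integrable_const _).indicator hA) ((integrable_const _).indicator hB),
      integral_indicator_const _ hA, integral_indicator_const _ hB]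
    simp only [smul_eq_mul]
    ring
  · intro h0
    have hf0 : f =ᵐ[μ] 0 := by
      filter_upwards [fm.coeFn_toLp, (Lp.eq_zero_iff_ae_eq_zero).mp h0] with ω h₁ h₂
      rw [← h₁, h₂]
    refine hA0 (measure_mono_null (fun ω hω => ?_) hf0)
    show ¬ f ω = 0
    rw [fA hω]
    positivity
  · filter_upwards [fm.coeFn_toLp] with ω hω
    rw [hω]
    refine ⟨fun h' => ?_, fun h' => ?_, fun h₁ h₂ => by simp [f, h₁, h₂]⟩
    · rw [fA h']
      exact ⟨by positivity, by nlinarith⟩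
    · rw [fB h']
      exact ⟨by nlinarith, neg_nonpos.mpr (by positivity)⟩

/-! ### Minimising the total second moment -/

/-- The allocations of `S` each of whose components is bounded by `M` and dominates the
corresponding component of `y` in the concave order. -/
def boundedImprovements (μ : Measure Ω) {n : ℕ} (y : Fin n → Ω → ℝ) (S : Lp ℝ 2 μ) (M : ℝ) :
    Set (PiLp 2 fun _ : Fin n => Lp ℝ 2 μ) :=
  {Z | ∑ i, Z i = S ∧ ∀ i, Z i ∈ boundedConcaveUpper μ (y i) M}

theorem exists_minimal_improvement {n : ℕ} {y : Fin n → Ω → ℝ} {S : Lp ℝ 2 μ} {M : ℝ}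
    (hne : (boundedImprovements μ y S M).Nonempty) :
    ∃ Z ∈ boundedImprovements μ y S M, ∀ W ∈ boundedImprovements μ y S M,
      ∑ i, ‖Z i‖ ^ 2 ≤ ∑ i, ‖W i‖ ^ 2 := by
  have hcl : IsClosed (boundedImprovements μ y S M) := by
    have : boundedImprovements μ y S M = {Z | ∑ i, Z i = S} ∩
        ⋂ i, (fun Z : PiLp 2 fun _ : Fin n => Lp ℝ 2 μ => Z i) ⁻¹'
          boundedConcaveUpper μ (y i) M := by
      ext Z; simp [boundedImprovements]
    rw [this]
    refine IsClosed.inter (isClosed_eq (by fun_prop) continuous_const)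
      (isClosed_iInter fun i => (isClosed_boundedConcaveUpper _ _).preimage (by fun_prop))
  have hcv : Convex ℝ (boundedImprovements μ y S M) := by
    rintro Z ⟨hZ, hZ'⟩ W ⟨hW, hW'⟩ a b ha hb hab
    refine ⟨?_, fun i => convex_boundedConcaveUpper _ _ (hZ' i) (hW' i) ha hb hab⟩
    simp only [PiLp.add_apply, PiLp.smul_apply, Finset.sum_add_distrib, ← Finset.smul_sum,
      hZ, hW, ← add_smul, hab, one_smul]
  -- The minimiser is the projection of the origin; the `PiLp 2` norm squared is the objective.
  obtain ⟨Z, hZ, hmin⟩ := exists_norm_eq_iInf_of_complete_convex hne hcl.isComplete hcv 0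
  refine ⟨Z, hZ, fun W hW => ?_⟩
  rw [← PiLp.norm_sq_eq_of_L2, ← PiLp.norm_sq_eq_of_L2]
  have hle : ‖Z‖ ≤ ‖W‖ := by
    have := ciInf_le (f := fun w : boundedImprovements μ y S M =>
      ‖(0 : PiLp 2 fun _ : Fin n => Lp ℝ 2 μ) - w‖)
      ⟨0, Set.forall_mem_range.mpr fun _ => norm_nonneg _⟩ ⟨W, hW⟩
    rw [← hmin] at this
    simpa using this
  gcongr

/-- In an allocation minimising the total second moment among bounded improvements, no two
components move in opposite directions with positive probability. -/
theorem measure_eq_zero_or_of_minimal {n : ℕ} {y : Fin n → Ω → ℝ} {S : Lp ℝ 2 μ} {M : ℝ}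
    {Z : PiLp 2 fun _ : Fin n => Lp ℝ 2 μ} (hZ : Z ∈ boundedImprovements μ y S M)
    (hmin : ∀ W ∈ boundedImprovements μ y S M, ∑ i, ‖Z i‖ ^ 2 ≤ ∑ i, ‖W i‖ ^ 2)
    (i j : Fin n) {a b c d : ℝ} (hab : a < b) (hcd : c < d) :
    μ {ω | b < Z i ω ∧ Z j ω < c} = 0 ∨ μ {ω | Z i ω < a ∧ d < Z j ω} = 0 := by
  by_contra! hn
  obtain ⟨hA, hB⟩ := hn
  set A := {ω | b < Z i ω ∧ Z j ω < c} with hAdef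
  set B := {ω | Z i ω < a ∧ d < Z j ω} with hBdef
  have hij : i ≠ j := by
    rintro rfl
    obtain ⟨ω, hω⟩ := nonempty_of_measure_ne_zero hA
    obtain ⟨ω', hω'⟩ := nonempty_of_measure_ne_zero hB
    have := hω.1; have := hω.2; have := hω'.1; have := hω'.2
    linarith
  have mZ (k) : Measurable (Z k : Ω → ℝ) := (Lp.stronglyMeasurable (Z k)).measurable
  have mA : MeasurableSet A :=
    (measurableSet_lt measurable_const (mZ i)).inter (measurableSet_lt (mZ j) measurable_const)
  have mB : MeasurableSet B :=
    (measurableSet_lt (mZ i) measurable_const).inter (measurableSet_lt measurable_const (mZ j))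
  have hdis : Disjoint A B := Set.disjoint_left.mpr fun ω h h' => by
    have := h.1; have := h'.1; linarith
  -- Half of each gap is the most that can move without crossing the midpoints `(a + b) / 2` and `(c
  -- + d) / 2`.
  obtain ⟨w, hw0, hwne, hw⟩ := exists_balanced_transfer mA mB hdis hA hB
    (h := min ((b - a) / 2) ((d - c) / 2)) (lt_min (by linarith) (by linarith))
  have hl := min_le_left ((b - a) / 2) ((d - c) / 2)
  have hr := min_le_right ((b - a) / 2) ((d - c) / 2)
  have hwi : ∀ᵐ ω ∂μ, w ω ^ 2 ≤ w ω * (Z i ω - (a + b) / 2) := by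
    filter_upwards [hw] with ω h
    by_cases h₁ : ω ∈ A
    · have := h.1 h₁; have := h₁.1; nlinarith
    · by_cases h₂ : ω ∈ B
      · have := h.2.1 h₂; have := h₂.1; nlinarith
      · simp [h.2.2 h₁ h₂]
  have hwj : ∀ᵐ ω ∂μ, (-w : Lp ℝ 2 μ) ω ^ 2 ≤ (-w : Lp ℝ 2 μ) ω * (Z j ω - (c + d) / 2) := by
    filter_upwards [hw, Lp.coeFn_neg w] with ω h hn
    rw [hn, Pi.neg_apply]
    by_cases h₁ : ω ∈ A
    · have := h.1 h₁; have := h₁.2; nlinarith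
    · by_cases h₂ : ω ∈ B
      · have := h.2.1 h₂; have := h₂.2; nlinarith
      · simp [h.2.2 h₁ h₂]
  have hw0' : ∫ ω, (-w : Lp ℝ 2 μ) ω ∂μ = 0 := by
    rw [integral_congr_ae (Lp.coeFn_neg w)]
    simp only [Pi.neg_apply]
    rw [integral_neg, hw0, neg_zero]
  have hmi := abs_midpoint_le hA hB hab (fun ω h => h.1) (fun ω h => h.1) (hZ.2 i).1
  have hmj := abs_midpoint_le hB hA hcd (fun ω h => h.2) (fun ω h => h.2) (hZ.2 j).1
  let v : Fin n → Lp ℝ 2 μ := Pi.single i w + Pi.single j (-w)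
  have vi : v i = w := by simp [v, hij]
  have vj : v j = -w := by simp [v, hij.symm]
  have vk {k} (h₁ : k ≠ i) (h₂ : k ≠ j) : v k = 0 := by simp [v, h₁, h₂]
  have vsum : ∑ k, v k = 0 := by simp [v, Finset.sum_add_distrib]
  have hmem : WithLp.toLp 2 (fun k => Z k - v k) ∈ boundedImprovements μ y S M := by
    refine ⟨by simp [Finset.sum_sub_distrib, vsum, hZ.1], fun k => ?_⟩
    show Z k - v k ∈ _
    by_cases h₁ : k = i
    · subst h₁
      rw [vi]
      exact sub_mem_boundedConcaveUpper (hZ.2 k) hmi hw0 hwi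
    · by_cases h₂ : k = j
      · subst h₂
        rw [vj]
        exact sub_mem_boundedConcaveUpper (hZ.2 k) hmj hw0' hwj
      · rw [vk h₁ h₂, sub_zero]
        exact hZ.2 k
  refine absurd (hmin _ hmem) (not_le.mpr ?_)
  have hpos : 0 < ‖w‖ ^ 2 := by positivity
  have lti : ‖Z i - v i‖ ^ 2 < ‖Z i‖ ^ 2 := by
    rw [vi]
    linarith [norm_sub_sq_le_of_transfer hw0 hwi]
  refine Finset.sum_lt_sum (fun k _ => ?_) ⟨i, Finset.mem_univ _, lti⟩
  show ‖Z k - v k‖ ^ 2 ≤ ‖Z k‖ ^ 2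
  by_cases h₁ : k = i
  · subst h₁
    exact lti.le
  · by_cases h₂ : k = j
    · subst h₂
      rw [vj]
      have := norm_sub_sq_le_of_transfer hw0' hwj
      rw [norm_neg] at this
      linarith
    · rw [vk h₁ h₂, sub_zero]

/-! ### Comonotone improvement and the two frontiers -/

/-- Comonotone improvement: every allocation of bounded endowments is dominated, componentwise in
the increasing concave order, by a comonotone one. -/
theorem exists_comonotone_improvement {n : ℕ} (X Y : Fin n → Lp ℝ ∞ μ)
    (hY : Y ∈ Allocations μ X) :
    ∃ Z ∈ ComonotoneAllocations μ X, ∀ i, ICVLe μ (Y i) (Z i) := by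
  obtain ⟨M, hM⟩ := exists_ae_abs_le Y
  have mY (i) : MemLp (Y i) 2 μ := (Lp.memLp (Y i)).mono_exponent le_top
  let y : Fin n → Lp ℝ 2 μ := fun i => (mY i).toLp _
  have hy (i) : y i =ᵐ[μ] Y i := (mY i).coeFn_toLp
  have hmem : WithLp.toLp 2 y ∈ boundedImprovements μ (fun i => Y i) (∑ i, y i) M := by
    refine ⟨rfl, fun i => ⟨?_, fun φ _ => le_of_eq ?_⟩⟩
    · filter_upwards [hy i, hM i] with ω h h'
      exact (congrArg abs h).trans_le h'
    · refine integral_congr_ae ?_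
      filter_upwards [hy i] with ω h
      exact congrArg φ h.symm
  obtain ⟨Z, hZ, hmin⟩ := exists_minimal_improvement ⟨_, hmem⟩
  obtain ⟨A, hA, hAc⟩ := exists_ae_forall_mul_nonneg (f := fun i => (Z i : Ω → ℝ))
    fun i j _ _ _ _ hab hcd => measure_eq_zero_or_of_minimal hZ hmin i j hab hcd
  have mZ (i) : MemLp (Z i) ∞ μ :=
    memLp_top_of_bound (Lp.aestronglyMeasurable _) M (hZ.2 i).1
  have hco : ∀ᵐ ω ∂μ, ∀ i, (mZ i).toLp _ ω = Z i ω :=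
    ae_all_iff.mpr fun i => (mZ i).coeFn_toLp
  -- Comonotonicity is pointwise, so `A` is cut down to where the `L^∞` and `L²` representatives
  -- agree.
  refine ⟨fun i => (mZ i).toLp _, ⟨?_, A ∩ _, inter_mem hA hco, ?_⟩, fun i φ _ hφ _ _ => ?_⟩
  · show ∑ i, (mZ i).toLp _ = ∑ i, X i
    rw [← show ∑ i, Y i = ∑ i, X i from hY]
    refine Lp.ext ?_
    have hyall : ∀ᵐ ω ∂μ, ∀ i, y i ω = Y i ω := ae_all_iff.mpr hy
    have hs : (∑ i, Z i : Lp ℝ 2 μ) =ᵐ[μ] (∑ i, y i : Lp ℝ 2 μ) := by rw [hZ.1]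
    filter_upwards [Lp.coeFn_finsetSum Finset.univ fun i => (mZ i).toLp _,
      Lp.coeFn_finsetSum Finset.univ Y, Lp.coeFn_finsetSum Finset.univ y,
      Lp.coeFn_finsetSum Finset.univ fun i => Z i, hs, hco, hyall] with ω h₁ h₂ h₃ h₄ h₅ h₆ h₇
    rw [h₁, h₂]
    rw [h₃, h₄] at h₅
    simpa [Finset.sum_apply, h₆, h₇] using h₅
  · rintro ω₁ ⟨h₁, h₁'⟩ ω₂ ⟨h₂, h₂'⟩ i j
    have h₁' : ∀ i, (mZ i).toLp _ ω₁ = Z i ω₁ := h₁'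
    have h₂' : ∀ i, (mZ i).toLp _ ω₂ = Z i ω₂ := h₂'
    rw [h₁', h₁', h₂', h₂']
    exact hAc ω₁ h₁ ω₂ h₂ i j
  · refine ((hZ.2 i).2 φ hφ).trans_eq (integral_congr_ae ?_)
    filter_upwards [hco] with ω h
    rw [h i]

end

end RiskSharing

theorem corollary3p10 {Ω : Type*} [MeasurableSpace Ω] (μ : Measure Ω) [IsProbabilityMeasure μ]
    (hμ : RiskSharing.Atomless μ) {n : ℕ} (X : Fin n → Lp ℝ ∞ μ) (U : Fin n → Lp ℝ ∞ μ → ℝ)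
    (hconc : ∀ i, ConcaveOn ℝ Set.univ (U i))
    (hssd : ∀ i, RiskSharing.SSDPreserving μ (U i))
    (hcash : ∀ i, RiskSharing.CashRegular μ (U i)) :
    RiskSharing.UPF μ U X = RiskSharing.CUPF μ U X := by
  have improve : ∀ Y ∈ RiskSharing.Allocations μ X,
      ∃ Z ∈ RiskSharing.ComonotoneAllocations μ X, ∀ i, U i (Y i) ≤ U i (Z i) := by
    intro Y hY
    obtain ⟨Z, hZ, h⟩ := RiskSharing.exists_comonotone_improvement X Y hY
    exact ⟨Z, hZ, fun i => hssd i _ _ (h i)⟩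
  ext u
  constructor
  · rintro ⟨Y, ⟨hY, hIR, hopt⟩, hu⟩
    obtain ⟨Z, hZ, hle⟩ := improve Y hY
    have hIRZ : RiskSharing.IndividuallyRational μ U X Z := fun i => (hIR i).trans (hle i)
    -- A strict gain would contradict optimality of `Y`, so `Z` realises the same utility vector.
    have heq (i) : U i (Y i) = U i (Z i) := (hle i).eq_of_not_lt fun hlt =>
      hopt ⟨Z, hZ.1, hIRZ, hle, i, hlt⟩
    refine ⟨Z, ⟨hZ, hIRZ, ?_⟩, fun i => (hu i).trans (heq i)⟩
    rintro ⟨W, hW, hIRW, hdom, i, hi⟩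
    exact hopt ⟨W, hW.1, hIRW, fun k => (heq k).trans_le (hdom k), i, (heq i).trans_lt hi⟩
  · rintro ⟨Y, ⟨hY, hIR, hopt⟩, hu⟩
    refine ⟨Y, ⟨hY.1, hIR, ?_⟩, hu⟩
    rintro ⟨W, hW, hIRW, hdom, i, hi⟩
    obtain ⟨Z, hZ, hle⟩ := improve W hW
    exact hopt ⟨Z, hZ, fun k => (hIRW k).trans (hle k), fun k => (hdom k).trans (hle k), i,
      hi.trans_le (hle i)⟩
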